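/- Let $\Gamma$ be a nonelementary (neither finite nor virtually $\mathbb{Z}$) group with a finite symmetric generating set $S\not\ni 1$ whose Cayley graph $G$, with graph metric $d$, is Gromov hyperbolic, and write $|g|=d(1,g)$. Let $\partial G$ be the set of geodesic rays from $1$ modulo bounded distance, with the quasi-metric $\rho(\xi,\xi')=e^{-(\xi|\xi')}$, where $$(\xi|\xi')=\sup\Bigl\{\liminf_{n,m\to\infty}\tfrac12\bigl(|x_n|+|x'_m|-d(x_n,x'_m)\bigr)\Bigr\},$$ the supremum being over the geodesic rays $(x_n)$, $(x'_m)$ from $1$ representing $\xi$, $\xi'$. Let $B(\xi,r)=\{\xi':\rho(\xi,\xi')<r\}$, and equip $\partial G$ with the topology induced by $\rho$ and its Borel $\sigma$-algebra. Let $P$ be a nearest neighbour Markov kernel on $G$ (steps go along edges), with $n$-step transition probabilities $p^n$, and let $\mathbb{P}$ be the distribution on $\Gamma^{\mathbb{Z}_{\ge0}}$ of the sample paths of the Markov chain with kernel $P$ started at $1$. Suppose the chain is regular with positive speed: there are reals $h\ge 0$ (entropy) and $l>0$ (speed) such that for $\mathbb{P}$-almost every $x=(x_n)_{n\ge 0}$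 $$\lim_{n\to\infty}\frac{-\log p^n(1,x_n)}{n}=h,\qquad \lim_{n\to\infty}\frac{|x_n|}{n}=l .$$ Then the harmonic measure $\nu$ of the chain exists and is unique. Here a harmonic measure is the image of $\mathbb{P}$ under a $\mathbb{P}$-almost everywhere measurable map $x\mapsto\xi_x\in\partial G$ such that, for $\mathbb{P}$-almost every $x$, some geodesic ray $\gamma$ from $1$ representing $\xi_x$ satisfies $\frac1n d(x_n,\gamma(\lfloor ln\rfloor))\to0$. Moreover, for every $\varepsilon>0$, $$\nu\Bigl(\Bigl\{\xi\in\partial G:\ \liminf_{r\to0}\frac{\log\nu(B(\xi,r))}{\log r}\ \ge\ \frac hl-\varepsilon\Bigr\}\Bigr)>0 .$$ -/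

import Mathlib

open MeasureTheory ProbabilityTheory Filter Topology

namespace HypBdry

section Geometry

variable {V : Type*}

/-- The Gromov product `(x | y)_w` for the graph metric of `G`. -/
noncomputable def gromovProduct (G : SimpleGraph V) (w x y : V) : ℝ :=
  ((G.dist x w : ℝ) + (G.dist y w : ℝ) - (G.dist x y : ℝ)) / 2

/-- The graph metric of `G` is `δ`-hyperbolic for some `δ ≥ 0`. -/
def IsHyperbolic (G : SimpleGraph V) : Prop :=
  ∃ δ : ℝ, 0 ≤ δ ∧ ∀ x y z w : V,
    min (gromovProduct G w x z) (gromovProduct G w y z) - δ ≤ gromovProduct G w x y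

/-- Unit speed geodesic rays starting from the base point `o`. -/
structure GeodesicRay (G : SimpleGraph V) (o : V) where
  /-- The successive vertices of the ray. -/
  vertex : ℕ → V
  vertex_zero : vertex 0 = o
  dist_vertex : ∀ m n : ℕ, m ≤ n → G.dist (vertex m) (vertex n) = n - m

/-- Two rays are identified when they are within a bounded distance of each other. -/
def raySetoid (G : SimpleGraph V) (o : V) : Setoid (GeodesicRay G o) where
  r γ γ' := ∃ C : ℕ, ∀ n : ℕ, G.edist (γ.vertex n) (γ'.vertex n) ≤ (C : ℕ∞)
  iseqv :=
    { refl := fun γ => ⟨0, fun n => by simp⟩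
      symm := by
        rintro γ γ' ⟨C, hC⟩
        exact ⟨C, fun n => by rw [SimpleGraph.edist_comm]; exact hC n⟩
      trans := by
        rintro γ₁ γ₂ γ₃ ⟨C, hC⟩ ⟨D, hD⟩
        refine ⟨C + D, fun n => ?_⟩
        rw [Nat.cast_add]
        exact (SimpleGraph.edist_triangle (v := γ₂.vertex n)).trans (add_le_add (hC n) (hD n)) }

/-- The Gromov boundary `∂G` (with base point `o`). -/
def Boundary (G : SimpleGraph V) (o : V) : Type _ :=
  Quotient (raySetoid G o)

/-- The point of `∂G` represented by a ray. -/
def GeodesicRay.toBoundary {G : SimpleGraph V} {o : V} (γ : GeodesicRay G o) : Boundary G o :=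
  Quotient.mk (raySetoid G o) γ

/-- The Gromov product on the boundary,
`(ξ | ξ') = sup { liminf_{n, m → ∞} (x_n | x'_m) }`, the supremum being over the geodesic rays
`x`, `x'` from `o` that represent `ξ`, `ξ'`. It may take the value `⊤`. -/
noncomputable def boundaryProduct (G : SimpleGraph V) (o : V) (ξ ξ' : Boundary G o) : EReal :=
  sSup {t : EReal | ∃ x x' : GeodesicRay G o, x.toBoundary = ξ ∧ x'.toBoundary = ξ' ∧
    t = liminf (fun p : ℕ × ℕ => ((gromovProduct G o (x.vertex p.1) (x'.vertex p.2) : ℝ) : EReal))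
      (atTop ×ˢ atTop)}

/-- The quasi-metric `ρ(ξ, ξ') = exp (-(ξ | ξ'))`, where `exp (-∞) = 0`. -/
noncomputable def rho (G : SimpleGraph V) (o : V) (ξ ξ' : Boundary G o) : ENNReal :=
  EReal.exp (-boundaryProduct G o ξ ξ')

/-- The ball `B(ξ, r)` of the quasi-metric `ρ`. -/
def rhoBall (G : SimpleGraph V) (o : V) (ξ : Boundary G o) (r : ℝ) : Set (Boundary G o) :=
  {ξ' | rho G o ξ ξ' < ENNReal.ofReal r}

lemma rhoBall_mono (G : SimpleGraph V) (o : V) (ξ : Boundary G o) {r s : ℝ} (h : r ≤ s) :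
    rhoBall G o ξ r ⊆ rhoBall G o ξ s :=
  fun _ hξ' => lt_of_lt_of_le hξ' (ENNReal.ofReal_le_ofReal h)

/-- The topology of `∂G` induced by the quasi-metric `ρ`. -/
instance (G : SimpleGraph V) (o : V) : TopologicalSpace (Boundary G o) where
  IsOpen U := ∀ ξ ∈ U, ∃ r : ℝ, 0 < r ∧ rhoBall G o ξ r ⊆ U
  isOpen_univ := fun _ _ => ⟨1, one_pos, Set.subset_univ _⟩
  isOpen_inter := by
    intro s t hs ht ξ hξ
    obtain ⟨r, hr, hrs⟩ := hs ξ hξ.1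
    obtain ⟨q, hq, hqt⟩ := ht ξ hξ.2
    exact ⟨min r q, lt_min hr hq, Set.subset_inter
      ((rhoBall_mono G o ξ (min_le_left r q)).trans hrs)
      ((rhoBall_mono G o ξ (min_le_right r q)).trans hqt)⟩
  isOpen_sUnion := by
    intro s hs ξ hξ
    obtain ⟨t, hts, hξt⟩ := hξ
    obtain ⟨r, hr, hrt⟩ := hs t hts ξ hξt
    exact ⟨r, hr, hrt.trans (Set.subset_sUnion_of_mem hts)⟩

/-- `∂G` carries its Borel σ-algebra. -/
instance (G : SimpleGraph V) (o : V) : MeasurableSpace (Boundary G o) :=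
  borel _

/-- The sample path `x` converges to the boundary point `ξ` at speed `l`: some geodesic ray `γ`
representing `ξ` satisfies `d(x_n, γ(l n)) / n → 0`. The time `l n` is rounded down to an integer,
as a ray is given by its successive vertices; this moves `γ(l n)` by less than `1`. -/
def ConvergesTo (G : SimpleGraph V) (o : V) (l : ℝ) (x : ℕ → V) (ξ : Boundary G o) : Prop :=
  ∃ γ : GeodesicRay G o, γ.toBoundary = ξ ∧
    Tendsto (fun n : ℕ => (G.dist (x n) (γ.vertex ⌊l * n⌋₊) : ℝ) / n) atTop (𝓝 0)

end Geometry

section Chain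

variable {V : Type*} [MeasurableSpace V]

/-- The transition kernel, given the path up to time `n`, of the Markov chain with kernel `P`. -/
noncomputable def pathStep (P : Kernel V V) (n : ℕ) :
    Kernel ((i : Finset.Iic n) → (fun _ : ℕ => V) i) V :=
  P.comap (fun y => y ⟨n, Finset.mem_Iic.2 le_rfl⟩) (measurable_pi_apply _)

instance (P : Kernel V V) [IsMarkovKernel P] (n : ℕ) : IsMarkovKernel (pathStep P n) := by
  unfold pathStep; infer_instance

/-- The distribution on `V^ℕ` of the sample paths of the Markov chain with kernel `P` starting
from `o`. -/
noncomputable def pathMeasure (P : Kernel V V) [IsMarkovKernel P] (o : V) : Measure (ℕ → V) :=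
  Kernel.traj (X := fun _ => V) (pathStep P) 0 (fun _ => o)

/-- The kernel `P` only moves along the edges of `G`. -/
def IsNearestNeighbor (G : SimpleGraph V) (P : Kernel V V) : Prop :=
  ∀ g : V, ∀ᵐ y ∂(P g), G.Adj g y

/-- The Markov chain with kernel `P` starting from `o` is regular, with entropy `h` and
speed `l`. Here `P ^ n` is the `n`-step transition kernel. -/
structure IsRegular (G : SimpleGraph V) (P : Kernel V V) [IsMarkovKernel P] (o : V)
    (h l : ℝ) : Prop where
  entropy_nonneg : 0 ≤ h
  speed_nonneg : 0 ≤ l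
  tendsto_entropy : ∀ᵐ x ∂(pathMeasure P o),
    Tendsto (fun n : ℕ => -Real.log (((P ^ n) o).real {x n}) / n) atTop (𝓝 h)
  tendsto_speed : ∀ᵐ x ∂(pathMeasure P o),
    Tendsto (fun n : ℕ => (G.dist o (x n) : ℝ) / n) atTop (𝓝 l)

/-- `ν` is the harmonic measure of the chain with speed `l`: the image of the path measure under
the (almost everywhere defined) boundary map, which sends a path to the point to which it
converges. -/
def IsHarmonicMeasure (G : SimpleGraph V) (P : Kernel V V) [IsMarkovKernel P] (o : V) (l : ℝ)
    (ν : Measure (Boundary G o)) : Prop :=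
  ∃ bnd : (ℕ → V) → Boundary G o, AEMeasurable bnd (pathMeasure P o) ∧
    (∀ᵐ x ∂(pathMeasure P o), ConvergesTo G o l x (bnd x)) ∧
    ν = (pathMeasure P o).map bnd

end Chain

/-- The lower local dimension `liminf_{r → 0} log ν(B(ξ, r)) / log r`, in the extended reals, with
`log 0 = -∞`. -/
noncomputable def lowerLocalDim {V : Type*} (G : SimpleGraph V) (o : V)
    (ν : Measure (Boundary G o)) (ξ : Boundary G o) : EReal :=
  liminf (fun r : ℝ => ENNReal.log (ν (rhoBall G o ξ r)) / ((Real.log r : ℝ) : EReal)) (𝓝[>] 0)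

/-- A group is elementary if it is finite or virtually infinite cyclic. -/
def IsElementary (Γ : Type*) [Group Γ] : Prop :=
  Finite Γ ∨ ∃ H : Subgroup Γ, H.FiniteIndex ∧ Nonempty (H ≃* Multiplicative ℤ)

end HypBdry

namespace HypBdry

/-! ### Rays, the boundary quasi-metric and shadows in a hyperbolic graph. -/

section Geometry

variable {V : Type*} {G : SimpleGraph V} {o : V} {δ : ℝ}

/-! A nearest neighbour path of positive speed follows a geodesic ray up to sublinear error
(`exists_tracks`), and two rays followed by the same path are equivalent (`Tracks.toBoundary_eq`).
The boundary map therefore exists and is unique almost everywhere; it is measurable because its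
preimages of open sets are, up to a null set, countable unions of shadows. This gives existence and
uniqueness of `ν`.

For the dimension, let `γ` be the ray followed by a path. The ball of radius about `e^{-k}` around
the class of `γ` has measure at most that of a shadow of `γ k` (`map_rhoBall_le_shadow`). A typical
path in this shadow is, at time `n ≈ k / l`, within `ε n + O(1)` of `γ k`, hence at one of at most
`exp (O(ε n + 1))` vertices, each of mass at most `exp (-n (h - ε))`. So the typical part of the
shadow has mass at most `exp (-k (h / l - O(ε)) + O(1))` (`measure_typicalPaths_inter_shadow_le`).

The whole shadow is compared with its typical part by a substitute for Lebesgue density,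
`ae_eventually_measure_shadow_le`: shadows at one level overlap boundedly, so those in which typical
paths have proportion below `e^{-kε}` carry summable typical mass, and Borel–Cantelli discards them.
The dimension bound thus holds `ν`-almost everywhere. -/

lemma dist_triangle_real (hc : G.Connected) (u v w : V) :
    (G.dist u w : ℝ) ≤ G.dist u v + G.dist v w := by
  exact_mod_cast hc.dist_triangle

lemma gromovProduct_comm (x y : V) : gromovProduct G o x y = gromovProduct G o y x := by
  simp only [gromovProduct, G.dist_comm (u := x) (v := y)]; ring

lemma gromovProduct_lipschitz (hc : G.Connected) (x y z : V) :
    gromovProduct G o x z - G.dist x y ≤ gromovProduct G o y z := by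
  have h1 := dist_triangle_real hc x y o
  have h2 := dist_triangle_real hc y x z
  rw [G.dist_comm (u := y) (v := x)] at h2
  simp only [gromovProduct]; linarith

lemma gromovProduct_lipschitz_right (hc : G.Connected) (x y z : V) :
    gromovProduct G o z x - G.dist x y ≤ gromovProduct G o z y := by
  rw [gromovProduct_comm z x, gromovProduct_comm z y]
  exact gromovProduct_lipschitz hc x y z

lemma gromovProduct_self (x : V) : gromovProduct G o x x = G.dist x o := by
  simp [gromovProduct]

lemma GeodesicRay.dist_base (γ : GeodesicRay G o) (n : ℕ) : G.dist (γ.vertex n) o = n := by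
  have := γ.dist_vertex 0 n (Nat.zero_le n)
  rwa [γ.vertex_zero, Nat.sub_zero, G.dist_comm] at this

lemma GeodesicRay.gromovProduct_of_le (γ : GeodesicRay G o) {k n : ℕ} (h : k ≤ n) :
    gromovProduct G o (γ.vertex k) (γ.vertex n) = k := by
  simp only [gromovProduct, γ.dist_base, γ.dist_vertex k n h]
  push_cast [h]; ring

lemma GeodesicRay.dist_vertex_le (γ : GeodesicRay G o) (m n : ℕ) :
    (G.dist (γ.vertex m) (γ.vertex n) : ℝ) ≤ |(m : ℝ) - n| := by
  rcases le_total m n with h | h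
  · rw [γ.dist_vertex m n h, abs_sub_comm]; push_cast [h]; exact le_abs_self _
  · rw [G.dist_comm, γ.dist_vertex n m h]; push_cast [h]; exact le_abs_self _

/-- Rays with a large Gromov product stay close for a long time. -/
lemma dist_le_of_le_gromovProduct (h0 : 0 ≤ δ) (hδ : ∀ x y z w : V,
      min (gromovProduct G w x z) (gromovProduct G w y z) - δ ≤ gromovProduct G w x y)
    (γ γ' : GeodesicRay G o) {k n m : ℕ} (hn : k ≤ n) (hm : k ≤ m)
    (h : (k : ℝ) ≤ gromovProduct G o (γ.vertex n) (γ'.vertex m)) :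
    (G.dist (γ.vertex k) (γ'.vertex k) : ℝ) ≤ 4 * δ := by
  -- Each of the two comparisons, through `γ n` and through `γ' m`, costs `δ`; a product of at least
  -- `k - 2δ` between two points at level `k` is a distance of at most `4δ`.
  have h1 := hδ (γ.vertex k) (γ'.vertex m) (γ.vertex n) o
  rw [γ.gromovProduct_of_le hn, gromovProduct_comm (γ'.vertex m), min_eq_left h] at h1
  have h2 := hδ (γ.vertex k) (γ'.vertex k) (γ'.vertex m) o
  rw [γ'.gromovProduct_of_le hm] at h2
  have h3 : (k : ℝ) - δ ≤ min (gromovProduct G o (γ.vertex k) (γ'.vertex m)) k :=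
    le_min h1 (by linarith)
  have h4 : gromovProduct G o (γ.vertex k) (γ'.vertex k)
      = k - (G.dist (γ.vertex k) (γ'.vertex k) : ℝ) / 2 := by
    simp only [gromovProduct, GeodesicRay.dist_base]; ring
  linarith

lemma toBoundary_eq_of_dist_le (hc : G.Connected) (γ γ' : GeodesicRay G o) {C : ℝ}
    (h : ∀ k, (G.dist (γ.vertex k) (γ'.vertex k) : ℝ) ≤ C) : γ.toBoundary = γ'.toBoundary := by
  refine Quotient.sound ⟨⌈C⌉₊, fun n => ?_⟩
  rw [← (hc.preconnected _ _).coe_dist_eq_edist]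
  have : G.dist (γ.vertex n) (γ'.vertex n) ≤ ⌈C⌉₊ := by
    exact_mod_cast (h n).trans (Nat.le_ceil C)
  exact_mod_cast this

/-- Hyperbolicity makes the bound uniform: if the rays stay within `C`, their points at level `k +
C` have product at least `k + C / 2`, so the rays are `4δ`-close at level `k`. -/
lemma dist_le_of_toBoundary_eq (hc : G.Connected) (h0 : 0 ≤ δ) (hδ : ∀ x y z w : V,
      min (gromovProduct G w x z) (gromovProduct G w y z) - δ ≤ gromovProduct G w x y)
    {γ γ' : GeodesicRay G o} (h : γ.toBoundary = γ'.toBoundary) (k : ℕ) :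
    (G.dist (γ.vertex k) (γ'.vertex k) : ℝ) ≤ 4 * δ := by
  obtain ⟨C, hC⟩ := Quotient.exact h
  refine dist_le_of_le_gromovProduct h0 hδ γ γ' (Nat.le_add_right k C) (Nat.le_add_right k C) ?_
  have h1 := hC (k + C)
  rw [← (hc.preconnected _ _).coe_dist_eq_edist] at h1
  have h2 : (G.dist (γ.vertex (k + C)) (γ'.vertex (k + C)) : ℝ) ≤ C := by exact_mod_cast h1
  simp only [gromovProduct, GeodesicRay.dist_base]
  push_cast; have : (0 : ℝ) ≤ C := C.cast_nonneg
  linarith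

/-- At level `k` the product is at least `k - R / 2`; moving out along each ray costs `δ`. One pair
of representatives suffices, the boundary product being a supremum. -/
lemma le_boundaryProduct (h0 : 0 ≤ δ) (hδ : ∀ x y z w : V,
      min (gromovProduct G w x z) (gromovProduct G w y z) - δ ≤ gromovProduct G w x y)
    (γ γ' : GeodesicRay G o) {k : ℕ} {R : ℝ}
    (h : (G.dist (γ.vertex k) (γ'.vertex k) : ℝ) ≤ R) :
    ((k - R / 2 - 2 * δ : ℝ) : EReal) ≤ boundaryProduct G o γ.toBoundary γ'.toBoundary := by
  refine le_trans ?_ (le_sSup ⟨γ, γ', rfl, rfl, rfl⟩)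
  refine le_liminf_of_le (by isBoundedDefault) ?_
  filter_upwards [(eventually_ge_atTop k).prod_mk (eventually_ge_atTop k)] with p hp
  rw [EReal.coe_le_coe_iff]
  have hR : 0 ≤ R := le_trans (Nat.cast_nonneg _) h
  have h4 : gromovProduct G o (γ.vertex k) (γ'.vertex k)
      = k - (G.dist (γ.vertex k) (γ'.vertex k) : ℝ) / 2 := by
    simp only [gromovProduct, GeodesicRay.dist_base]; ring
  have h1 := hδ (γ'.vertex p.2) (γ.vertex k) (γ'.vertex k) o
  rw [gromovProduct_comm (γ'.vertex p.2), γ'.gromovProduct_of_le hp.2, h4] at h1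
  have h2 := hδ (γ.vertex p.1) (γ'.vertex p.2) (γ.vertex k) o
  rw [gromovProduct_comm (γ.vertex p.1), γ.gromovProduct_of_le hp.1] at h2
  have h5 : (k : ℝ) - R / 2 ≤ min (k : ℝ) (k - (G.dist (γ.vertex k) (γ'.vertex k) : ℝ) / 2) :=
    le_min (by linarith) (by linarith)
  have h6 : (k : ℝ) - R / 2 - δ ≤
      min (k : ℝ) (gromovProduct G o (γ'.vertex p.2) (γ.vertex k)) :=
    le_min (by linarith) (by linarith)
  linarith

/-- A pair of representatives with product above `t` is `4δ`-close at level `k`; each change of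
representative adds another `4δ`. -/
lemma dist_le_of_lt_boundaryProduct (hc : G.Connected) (h0 : 0 ≤ δ) (hδ : ∀ x y z w : V,
      min (gromovProduct G w x z) (gromovProduct G w y z) - δ ≤ gromovProduct G w x y)
    (γ γ' : GeodesicRay G o) {k : ℕ} {t : ℝ}
    (h : (t : EReal) < boundaryProduct G o γ.toBoundary γ'.toBoundary) (hk : (k : ℝ) ≤ t) :
    (G.dist (γ.vertex k) (γ'.vertex k) : ℝ) ≤ 12 * δ := by
  obtain ⟨_, ⟨x, x', hx, hx', rfl⟩, hlt⟩ := lt_sSup_iff.1 h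
  obtain ⟨p, hp, hp1, hp2⟩ := ((eventually_lt_of_lt_liminf hlt (by isBoundedDefault)).and
    ((eventually_ge_atTop k).prod_mk (eventually_ge_atTop k))).exists
  have h1 := dist_le_of_le_gromovProduct h0 hδ x x' hp1 hp2 (hk.trans (EReal.coe_lt_coe_iff.1 hp).le)
  have h2 := dist_le_of_toBoundary_eq hc h0 hδ hx.symm k
  have h3 := dist_le_of_toBoundary_eq hc h0 hδ hx' k
  have h4 := dist_triangle_real hc (γ.vertex k) (x.vertex k) (γ'.vertex k)
  have h5 := dist_triangle_real hc (x.vertex k) (x'.vertex k) (γ'.vertex k)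
  linarith

lemma exists_rep (ξ : Boundary G o) : ∃ γ : GeodesicRay G o, γ.toBoundary = ξ :=
  Quotient.exists_rep ξ

/-- The quasi-ultrametric inequality. At level `⌊t⌋` the outer rays are `24δ`-close, which costs
`12δ + 2δ` in the product; the `1` pays for the floor. -/
lemma lt_boundaryProduct_of_lt_of_lt (hc : G.Connected) (h0 : 0 ≤ δ) (hδ : ∀ x y z w : V,
      min (gromovProduct G w x z) (gromovProduct G w y z) - δ ≤ gromovProduct G w x y)
    {ξ η ζ : Boundary G o} {t : ℝ} (ht : 0 ≤ t)
    (h : (t : EReal) < boundaryProduct G o ξ η) (h' : (t : EReal) < boundaryProduct G o η ζ) :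
    ((t - (1 + 14 * δ) : ℝ) : EReal) < boundaryProduct G o ξ ζ := by
  obtain ⟨γ₁, rfl⟩ := exists_rep ξ
  obtain ⟨γ₂, rfl⟩ := exists_rep η
  obtain ⟨γ₃, rfl⟩ := exists_rep ζ
  have hk := Nat.floor_le ht
  have h1 := dist_le_of_lt_boundaryProduct hc h0 hδ γ₁ γ₂ h hk
  have h2 := dist_le_of_lt_boundaryProduct hc h0 hδ γ₂ γ₃ h' hk
  have h3 := dist_triangle_real hc (γ₁.vertex ⌊t⌋₊) (γ₂.vertex ⌊t⌋₊) (γ₃.vertex ⌊t⌋₊)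
  refine lt_of_lt_of_le ?_ (le_boundaryProduct h0 hδ γ₁ γ₃ (h3.trans (add_le_add h1 h2)))
  rw [EReal.coe_lt_coe_iff]
  have := Nat.lt_floor_add_one t
  linarith

lemma mem_rhoBall_exp (ξ η : Boundary G o) (t : ℝ) :
    η ∈ rhoBall G o ξ (Real.exp (-t)) ↔ (t : EReal) < boundaryProduct G o ξ η := by
  rw [rhoBall, Set.mem_ofPred_eq, rho, ← EReal.exp_coe, EReal.exp_lt_exp_iff, EReal.coe_neg,
    EReal.neg_lt_neg_iff]

/-- The points that a chain of ever smaller balls joins to the ball of radius `exp (-t)`. -/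
def chainSet (G : SimpleGraph V) (o : V) (ξ : Boundary G o) (t c : ℝ) : ℕ → Set (Boundary G o)
  | 0 => {η | (t : EReal) < boundaryProduct G o ξ η}
  | i + 1 => {ζ | ∃ η ∈ chainSet G o ξ t c i,
      ((t + (i + 1) * c : ℝ) : EReal) < boundaryProduct G o η ζ}

/-- Balls of `ρ` need not be open, but each lies in an open set of comparable size. -/
lemma exists_isOpen_rhoBall_subset (hc : G.Connected) (h0 : 0 ≤ δ) (hδ : ∀ x y z w : V,
      min (gromovProduct G w x z) (gromovProduct G w y z) - δ ≤ gromovProduct G w x y)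
    (ξ : Boundary G o) {t : ℝ} (ht : 0 ≤ t) :
    ∃ U : Set (Boundary G o), IsOpen U ∧ rhoBall G o ξ (Real.exp (-t)) ⊆ U ∧
      ∀ η ∈ U, ((t - (1 + 14 * δ) : ℝ) : EReal) < boundaryProduct G o ξ η := by
  set c : ℝ := 1 + 14 * δ with hcdef
  have hc0 : 0 ≤ c := by positivity
  -- The thresholds of the links grow by `c`, exactly the loss in the quasi-ultrametric inequality.
  -- Merging the last two links thus leaves a shorter admissible chain, and the total loss is a
  -- single `c`.
  have key : ∀ i : ℕ, ∀ η ∈ chainSet G o ξ t c i, ∀ ζ,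
      ((t + i * c : ℝ) : EReal) < boundaryProduct G o η ζ →
      ((t - c : ℝ) : EReal) < boundaryProduct G o ξ ζ := by
    intro i
    induction i with
    | zero =>
      intro η hη ζ hζ
      exact lt_boundaryProduct_of_lt_of_lt hc h0 hδ ht hη (by simpa using hζ)
    | succ i ih =>
      rintro η ⟨η', hη', hlt⟩ ζ hζ
      refine ih η' hη' ζ ?_
      push_cast at hζ
      have := lt_boundaryProduct_of_lt_of_lt hc h0 hδ (by positivity) hlt (by exact_mod_cast hζ)
      convert this using 2
      rw [← hcdef]; ring
  have hself : ∀ (ζ : Boundary G o) (s : ℝ), (s : EReal) < boundaryProduct G o ζ ζ := by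
    intro ζ s
    obtain ⟨γ, rfl⟩ := exists_rep ζ
    obtain ⟨k, hk⟩ := exists_nat_gt (s + 2 * δ)
    refine lt_of_lt_of_le ?_ (le_boundaryProduct (k := k) (R := 0) h0 hδ γ γ (by simp))
    rw [EReal.coe_lt_coe_iff]; linarith
  refine ⟨⋃ i, chainSet G o ξ t c i, ?_, ?_, ?_⟩
  · intro η hη
    obtain ⟨i, hi⟩ := Set.mem_iUnion.1 hη
    refine ⟨Real.exp (-(t + (i + 1) * c)), Real.exp_pos _, fun ζ hζ => ?_⟩
    exact Set.mem_iUnion.2 ⟨i + 1, η, hi, (mem_rhoBall_exp _ _ _).1 hζ⟩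
  · intro η hη
    exact Set.mem_iUnion.2 ⟨0, (mem_rhoBall_exp _ _ _).1 hη⟩
  · intro η hη
    obtain ⟨i, hi⟩ := Set.mem_iUnion.1 hη
    exact key i η hi η (hself _ _)

/-- The path `x` follows the ray `γ` at speed `l`, up to a sublinear error. -/
def Tracks (G : SimpleGraph V) (o : V) (l : ℝ) (x : ℕ → V) (γ : GeodesicRay G o) : Prop :=
  Tendsto (fun n : ℕ => (G.dist (x n) (γ.vertex ⌊l * n⌋₊) : ℝ) / n) atTop (𝓝 0)

lemma Tracks.eventually_dist_le {l : ℝ} {x : ℕ → V} {γ : GeodesicRay G o} (h : Tracks G o l x γ)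
    {ε : ℝ} (hε : 0 < ε) :
    ∀ᶠ n : ℕ in atTop, (G.dist (x n) (γ.vertex ⌊l * n⌋₊) : ℝ) ≤ ε * n := by
  filter_upwards [h.eventually_lt_const hε, eventually_gt_atTop 0] with n hn hn0
  have : (0 : ℝ) < n := by exact_mod_cast hn0
  exact ((div_lt_iff₀ this).1 hn).le

/-- For large `n`, `x n` is within `l n / 2` of `γ ⌊l n⌋`, so their product is at least `⌊l n⌋ - l n
/ 2 ≥ k`; passing to `γ k` costs `δ`. -/
lemma Tracks.eventually_le_gromovProduct (hc : G.Connected) (hδ : ∀ x y z w : V,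
      min (gromovProduct G w x z) (gromovProduct G w y z) - δ ≤ gromovProduct G w x y)
    {l : ℝ} (hl : 0 < l) {x : ℕ → V} {γ : GeodesicRay G o} (h : Tracks G o l x γ) (k : ℕ) :
    ∀ᶠ n : ℕ in atTop, (k : ℝ) - δ ≤ gromovProduct G o (γ.vertex k) (x n) := by
  have hlarge : ∀ᶠ n : ℕ in atTop, (k : ℝ) + 1 ≤ l / 2 * n :=
    (tendsto_natCast_atTop_atTop.const_mul_atTop (by positivity)).eventually_ge_atTop _
  filter_upwards [h.eventually_dist_le (half_pos hl), hlarge] with n hn hn'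
  have hf := Nat.lt_floor_add_one (l * n)
  have hkf : k ≤ ⌊l * n⌋₊ := by
    refine Nat.le_floor ?_
    have : 0 ≤ l / 2 * n := by positivity
    linarith
  have h1 := dist_triangle_real hc (γ.vertex ⌊l * n⌋₊) (x n) o
  rw [γ.dist_base, G.dist_comm (u := γ.vertex _) (v := x n)] at h1
  have h2 : (k : ℝ) ≤ gromovProduct G o (x n) (γ.vertex ⌊l * n⌋₊) := by
    simp only [gromovProduct, γ.dist_base]; linarith
  have h3 := hδ (γ.vertex k) (x n) (γ.vertex ⌊l * n⌋₊) o
  rw [γ.gromovProduct_of_le hkf, min_eq_left h2] at h3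
  exact h3

lemma Tracks.toBoundary_eq (hc : G.Connected) (h0 : 0 ≤ δ) (hδ : ∀ x y z w : V,
      min (gromovProduct G w x z) (gromovProduct G w y z) - δ ≤ gromovProduct G w x y)
    {l : ℝ} (hl : 0 < l) {x : ℕ → V} {γ γ' : GeodesicRay G o} (h : Tracks G o l x γ)
    (h' : Tracks G o l x γ') : γ.toBoundary = γ'.toBoundary := by
  refine toBoundary_eq_of_dist_le hc γ γ' (C := 4 * δ) fun k => ?_
  -- The two rays are compared at level `k'`, where their product is at least `k' - 2δ ≥ k`.
  set k' := k + ⌈2 * δ⌉₊ with hk'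
  have hk2 : (k : ℝ) + 2 * δ ≤ k' := by
    rw [hk']; push_cast; linarith [Nat.le_ceil (2 * δ)]
  obtain ⟨n, h1, h2⟩ := ((h.eventually_le_gromovProduct hc hδ hl k').and
    (h'.eventually_le_gromovProduct hc hδ hl k')).exists
  have hkk : k ≤ k' := Nat.le_add_right _ _
  refine dist_le_of_le_gromovProduct h0 hδ γ γ' hkk hkk ?_
  have h3 := hδ (γ.vertex k') (γ'.vertex k') (x n) o
  linarith [le_min h1 h2]

/-- The paths that end up in the shadow of the ball of radius `c` around `w`, seen from `o`. -/
def shadow (G : SimpleGraph V) (o : V) (c : ℝ) (w : V) : Set (ℕ → V) :=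
  {x | ∀ᶠ n in atTop, (G.dist w o : ℝ) - c ≤ gromovProduct G o w (x n)}

/-- With the converse `Tracks.mem_shadow`, this translates shadows, which are events on the
coordinates, into limit rays passing near `w`. -/
lemma Tracks.dist_le_of_mem_shadow (hc : G.Connected) (h0 : 0 ≤ δ) (hδ : ∀ x y z w : V,
      min (gromovProduct G w x z) (gromovProduct G w y z) - δ ≤ gromovProduct G w x y)
    {l : ℝ} (hl : 0 < l) {x : ℕ → V} {γ : GeodesicRay G o} (h : Tracks G o l x γ)
    {c : ℝ} (hc0 : 0 ≤ c) {w : V} (hx : x ∈ shadow G o c w) :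
    (G.dist w (γ.vertex (G.dist w o)) : ℝ) ≤ 2 * c + 4 * δ := by
  obtain ⟨n, h1, h2⟩ := ((h.eventually_le_gromovProduct hc hδ hl (G.dist w o)).and hx).exists
  have h3 := hδ w (γ.vertex (G.dist w o)) (x n) o
  have h4 : (G.dist w o : ℝ) - c - δ ≤ min (gromovProduct G o w (x n))
      (gromovProduct G o (γ.vertex (G.dist w o)) (x n)) := le_min (by linarith) (by linarith)
  have h5 := h4.trans (sub_le_iff_le_add.1 h3)
  simp only [gromovProduct, GeodesicRay.dist_base] at h5
  linarith

lemma Tracks.mem_shadow (hc : G.Connected) (hδ : ∀ x y z w : V,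
      min (gromovProduct G w x z) (gromovProduct G w y z) - δ ≤ gromovProduct G w x y)
    {l : ℝ} (hl : 0 < l) {x : ℕ → V} {γ : GeodesicRay G o} (h : Tracks G o l x γ)
    {R : ℝ} {w : V} (hw : (G.dist w (γ.vertex (G.dist w o)) : ℝ) ≤ R) :
    x ∈ shadow G o (R + δ) w := by
  filter_upwards [h.eventually_le_gromovProduct hc hδ hl (G.dist w o)] with n hn
  have := gromovProduct_lipschitz (o := o) hc (γ.vertex (G.dist w o)) w (x n)
  rw [G.dist_comm (u := γ.vertex _)] at this
  linarith

/-! ### Local finiteness, and paths of positive speed. -/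

lemma exists_adj_dist_eq (hc : G.Connected) {u v : V} {n : ℕ} (h : G.dist u v = n + 1) :
    ∃ w, G.Adj u w ∧ G.dist w v = n := by
  obtain ⟨p, hp⟩ := hc.exists_walk_length_eq_dist u v
  cases p with
  | nil => simp at h
  | @cons _ w _ hadj q =>
    refine ⟨w, hadj, ?_⟩
    have h1 := G.dist_le q
    have h2 := hc.dist_triangle (u := u) (v := w) (w := v)
    have h3 : G.dist u w = 1 := SimpleGraph.dist_eq_one_iff_adj.2 hadj
    rw [SimpleGraph.Walk.length_cons] at hp
    omega

lemma exists_finset_ball (hc : G.Connected) {D : ℕ} {N : V → Finset V}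
    (hD : ∀ u, (N u).card ≤ D) (hN : ∀ u v, G.Adj u v → v ∈ N u) (w : V) (n : ℕ) :
    ∃ F : Finset V, F.card ≤ (D + 1) ^ n ∧ ∀ v, G.dist v w ≤ n → v ∈ F := by
  classical
  induction n with
  | zero =>
    refine ⟨{w}, by simp, fun v hv => ?_⟩
    simpa using hc.dist_eq_zero_iff.1 (Nat.le_zero.1 hv)
  | succ n ih =>
    obtain ⟨F, hF, hF'⟩ := ih
    refine ⟨F.biUnion fun u => insert u (N u), ?_, fun v hv => ?_⟩
    · refine (Finset.card_biUnion_le_card_mul F _ (D + 1) fun u _ =>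
        (Finset.card_insert_le _ _).trans (Nat.succ_le_succ (hD u))).trans ?_
      rw [pow_succ]; gcongr
    · rw [Finset.mem_biUnion]
      rcases Nat.le_or_eq_of_le_succ hv with h | h
      · exact ⟨v, hF' v h, Finset.mem_insert_self _ _⟩
      · obtain ⟨u, hu, hun⟩ := exists_adj_dist_eq hc h
        exact ⟨u, hF' u hun.le, Finset.mem_insert_of_mem (hN u v hu.symm)⟩

/-- A path going to infinity in a locally finite graph has a geodesic ray each of whose points
lies on a geodesic from `o` to `x m` for infinitely many `m`. -/
lemma exists_geodesicRay (hc : G.Connected) {N : V → Finset V}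
    (hN : ∀ u v, G.Adj u v → v ∈ N u) {x : ℕ → V}
    (hx : Tendsto (fun n => G.dist o (x n)) atTop atTop) :
    ∃ γ : GeodesicRay G o, ∀ k, ∃ᶠ m in atTop,
      G.dist o (x m) = k + G.dist (γ.vertex k) (x m) := by
  -- König's lemma: infinitely many of the geodesics to the `x m` leave `v` through the same one of
  -- its finitely many neighbours.
  have step : ∀ (k : ℕ) (v : V), (∃ᶠ m in atTop, G.dist o (x m) = k + G.dist v (x m)) →
      ∃ w, G.Adj v w ∧ ∃ᶠ m in atTop, G.dist o (x m) = (k + 1) + G.dist w (x m) := by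
    intro k v hv
    have h1 : ∃ᶠ m in atTop, ∃ w ∈ N v, G.Adj v w ∧
        G.dist o (x m) = (k + 1) + G.dist w (x m) := by
      refine (hv.and_eventually (hx.eventually_ge_atTop (k + 1))).mono ?_
      rintro m ⟨hm, hm'⟩
      obtain ⟨w, hw, hwd⟩ := exists_adj_dist_eq (n := G.dist v (x m) - 1) hc
        (show G.dist v (x m) = _ by omega)
      exact ⟨w, hN v w hw, hw, by omega⟩
    by_contra hcon
    push Not at hcon
    refine h1 ?_
    have : ∀ w ∈ N v, ∀ᶠ m in atTop, ¬ (G.Adj v w ∧ G.dist o (x m) = (k + 1) + G.dist w (x m)) := by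
      intro w _
      by_cases hw : G.Adj v w
      · have h2 := hcon w hw
        filter_upwards [h2] with m hm h3 using hm h3.2
      · exact Eventually.of_forall fun m h3 => hw h3.1
    filter_upwards [(Filter.eventually_all_finset (N v)).2 this] with m hm
    rintro ⟨w, hw, h3⟩
    exact hm w hw h3
  choose! f hadj hf using step
  let s : ℕ → V := fun k => Nat.rec o (fun k v => f k v) k
  have hs : ∀ k, ∃ᶠ m in atTop, G.dist o (x m) = k + G.dist (s k) (x m) := by
    intro k
    induction k with
    | zero => exact Frequently.of_forall fun m => (Nat.zero_add _).symm
    | succ k ih => exact_mod_cast hf k (s k) ih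
  have hadj' : ∀ k, G.Adj (s k) (s (k + 1)) := fun k => hadj k (s k) (hs k)
  have hbase : ∀ k, k ≤ G.dist o (s k) := by
    intro k
    obtain ⟨m, hm⟩ := (hs k).exists
    have := hc.dist_triangle (u := o) (v := s k) (w := x m)
    omega
  have hle : ∀ m n : ℕ, m ≤ n → G.dist (s m) (s n) ≤ n - m := by
    intro m n hmn
    induction n, hmn using Nat.le_induction with
    | base => simp
    | succ n hmn ih =>
      have h1 := hc.dist_triangle (u := s m) (v := s n) (w := s (n + 1))
      have h2 : G.dist (s n) (s (n + 1)) = 1 := SimpleGraph.dist_eq_one_iff_adj.2 (hadj' n)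
      omega
  refine ⟨⟨s, rfl, fun m n hmn => le_antisymm (hle m n hmn) ?_⟩, hs⟩
  have h1 := hc.dist_triangle (u := o) (v := s m) (w := s n)
  have h2 := hle 0 m (Nat.zero_le m)
  have h3 := hbase n
  change G.dist o (s m) ≤ _ at h2
  omega

/-- A nearest neighbour path of positive speed `l` moves along its limit direction. -/
lemma eventually_le_gromovProduct_of_speed (hc : G.Connected) (h0 : 0 ≤ δ) (hδ : ∀ x y z w : V,
      min (gromovProduct G w x z) (gromovProduct G w y z) - δ ≤ gromovProduct G w x y)
    {l : ℝ} (hl : 0 < l) {x : ℕ → V} (hx : ∀ n, G.Adj (x n) (x (n + 1)))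
    (hs : Tendsto (fun n : ℕ => (G.dist o (x n) : ℝ) / n) atTop (𝓝 l))
    {ε : ℝ} (hε : 0 < ε) :
    ∀ᶠ n : ℕ in atTop, ∀ m ≥ n, (l - ε) * n ≤ gromovProduct G o (x n) (x m) := by
  wlog hεl : ε < l generalizing ε
  · filter_upwards [this (half_pos hl) (half_lt_self hl)] with n hn m hm
    refine le_trans ?_ (hn m hm)
    gcongr; linarith
  set a := l - ε / 2 with ha
  have ha0 : 0 < a := by linarith
  have hstep : ∀ n k, (G.dist (x n) (x (n + k)) : ℝ) ≤ k := by
    intro n k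
    induction k with
    | zero => simp
    | succ k ih =>
      have h1 := dist_triangle_real hc (x n) (x (n + k)) (x (n + (k + 1)))
      have h2 : G.dist (x (n + k)) (x (n + (k + 1))) = 1 :=
        SimpleGraph.dist_eq_one_iff_adj.2 (hx _)
      rw [h2] at h1; push_cast at h1 ⊢; linarith
  -- In a block of `K` steps the lower bound `a n` on the distance to `o` grows by `a K ≥ δ`. This
  -- pays for one use of hyperbolicity, so no error accumulates over many blocks.
  obtain ⟨K, hK⟩ := exists_nat_gt (δ / a)
  have hK0 : 0 < K := by
    have : (0 : ℝ) < K := lt_of_le_of_lt (by positivity) hK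
    exact_mod_cast this
  have hKδ : δ ≤ a * K := by
    have := (div_lt_iff₀ ha0).1 hK
    linarith
  obtain ⟨M, hM⟩ : ∃ M : ℕ, ∀ n ≥ M, a * n ≤ G.dist (x n) o := by
    obtain ⟨M, hM⟩ := eventually_atTop.1 (hs.eventually_const_lt (show a < l by linarith))
    refine ⟨M + 1, fun n hn => ?_⟩
    have hn0 : (0 : ℝ) < n := by exact_mod_cast (Nat.succ_pos M).trans_le hn
    have := (lt_div_iff₀ hn0).1 (hM n (by omega))
    rw [G.dist_comm]; exact this.le
  -- The induction prepends a block: the bound for the path from `n + K` on is better by `a K`,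
  -- which absorbs the `δ`.
  have hj : ∀ j n : ℕ, M ≤ n → a * n - K - δ ≤ gromovProduct G o (x n) (x (n + j * K)) := by
    intro j
    induction j with
    | zero =>
      intro n hn
      rw [Nat.zero_mul, Nat.add_zero, gromovProduct_self]
      have : (0 : ℝ) ≤ K := K.cast_nonneg
      linarith [hM n hn]
    | succ j ih =>
      intro n hn
      have h1 := ih (n + K) (by omega)
      rw [show n + K + j * K = n + (j + 1) * K by ring, gromovProduct_comm] at h1
      push_cast at h1
      have h2 : a * n - K ≤ gromovProduct G o (x n) (x (n + K)) := by
        have h3 := hM n hn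
        have h4 := hM (n + K) (by omega)
        have h5 := hstep n K
        have : (0 : ℝ) ≤ a * K := by positivity
        push_cast at h4
        have : (0 : ℝ) ≤ K := K.cast_nonneg
        simp only [gromovProduct]; linarith
      have h3 := hδ (x n) (x (n + (j + 1) * K)) (x (n + K)) o
      have h4 : a * n - K ≤ min (gromovProduct G o (x n) (x (n + K)))
        (gromovProduct G o (x (n + (j + 1) * K)) (x (n + K))) := le_min h2 (by linarith)
      linarith
  have hlarge : ∀ᶠ n : ℕ in atTop, 2 * (K : ℝ) + δ ≤ ε / 2 * n :=
    (tendsto_natCast_atTop_atTop.const_mul_atTop (by positivity)).eventually_ge_atTop _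
  filter_upwards [hlarge, eventually_ge_atTop M] with n hn hnM m hm
  obtain ⟨d, rfl⟩ := Nat.exists_eq_add_of_le hm
  have h1 := hj (d / K) n hnM
  have h2 := hstep (n + d / K * K) (d % K)
  rw [show n + d / K * K + d % K = n + d by rw [add_assoc, Nat.div_add_mod']] at h2
  have h3 := gromovProduct_lipschitz_right (o := o) hc (x (n + d / K * K)) (x (n + d)) (x n)
  have h4 : ((d % K : ℕ) : ℝ) ≤ K := by exact_mod_cast (Nat.mod_lt d hK0).le
  have h5 : (l - ε) * n = a * n - ε / 2 * n := by rw [ha]; ring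
  linarith

/-- With `k = ⌊l n⌋`, the point `γ k` lies on a geodesic to a late `x m`, so both `γ k` and `x n`
have product about `l n` with `x m`, hence with each other. Both being at distance about `l n` from
`o`, they are close. -/
lemma exists_tracks (hc : G.Connected) (h0 : 0 ≤ δ) (hδ : ∀ x y z w : V,
      min (gromovProduct G w x z) (gromovProduct G w y z) - δ ≤ gromovProduct G w x y)
    {N : V → Finset V} (hN : ∀ u v, G.Adj u v → v ∈ N u)
    {l : ℝ} (hl : 0 < l) {x : ℕ → V} (hx : ∀ n, G.Adj (x n) (x (n + 1)))
    (hs : Tendsto (fun n : ℕ => (G.dist o (x n) : ℝ) / n) atTop (𝓝 l)) :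
    ∃ γ : GeodesicRay G o, Tracks G o l x γ := by
  have hinf : Tendsto (fun n => G.dist o (x n)) atTop atTop := by
    rw [← tendsto_natCast_atTop_iff (R := ℝ)]
    have h1 := hs.pos_mul_atTop hl tendsto_natCast_atTop_atTop
    refine h1.congr' ?_
    filter_upwards [eventually_gt_atTop 0] with n hn
    have : (n : ℝ) ≠ 0 := by exact_mod_cast hn.ne'
    field_simp
  obtain ⟨γ, hγ⟩ := exists_geodesicRay hc hN hinf
  refine ⟨γ, ?_⟩
  have key : ∀ ε : ℝ, 0 < ε → ∀ᶠ n : ℕ in atTop,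
      (G.dist (x n) (γ.vertex ⌊l * n⌋₊) : ℝ) / n < ε := by
    intro ε hε
    have hlarge : ∀ᶠ n : ℕ in atTop, 2 + 2 * δ ≤ ε / 8 * n :=
      (tendsto_natCast_atTop_atTop.const_mul_atTop (by positivity)).eventually_ge_atTop _
    filter_upwards [hlarge, eventually_gt_atTop 0, hs.eventually_lt_const
      (show l < l + ε / 8 by linarith), eventually_le_gromovProduct_of_speed (o := o) hc h0 hδ hl hx hs
      (show 0 < ε / 8 by positivity)] with n hn hn0 hn1 hn2
    have hnpos : (0 : ℝ) < n := by exact_mod_cast hn0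
    rw [div_lt_iff₀ hnpos] at hn1 ⊢
    set k := ⌊l * n⌋₊
    have hk1 : (k : ℝ) ≤ l * n := Nat.floor_le (by positivity)
    have hk2 : l * n < k + 1 := Nat.lt_floor_add_one _
    obtain ⟨m, hm, hmn⟩ := ((hγ k).and_eventually (eventually_ge_atTop n)).exists
    have h1 : (k : ℝ) ≤ gromovProduct G o (γ.vertex k) (x m) := by
      have : (G.dist o (x m) : ℝ) = k + G.dist (γ.vertex k) (x m) := by exact_mod_cast hm
      simp only [gromovProduct, γ.dist_base, G.dist_comm (u := x m) (v := o)]; linarith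
    have h2 := hδ (γ.vertex k) (x n) (x m) o
    have h3 : (l - ε / 8) * n - 1 ≤ min (gromovProduct G o (γ.vertex k) (x m))
        (gromovProduct G o (x n) (x m)) := by
      refine le_min ?_ (by linarith [hn2 m hmn])
      have : 0 ≤ ε / 8 * n := by positivity
      linarith
    have h4 := h3.trans (sub_le_iff_le_add.1 h2)
    simp only [gromovProduct, γ.dist_base, G.dist_comm (u := x n) (v := o)] at h4
    rw [G.dist_comm]
    have : 0 < ε * n := by positivity
    linarith
  rw [Tracks, tendsto_order]
  refine ⟨fun a ha => Eventually.of_forall fun n => lt_of_lt_of_le ha (by positivity), key⟩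

end Geometry

end HypBdry

namespace HypBdry

/-! ### The path measure: marginals and edge steps. -/

section Markov

variable {V : Type*} [MeasurableSpace V]

instance (P : Kernel V V) [IsMarkovKernel P] (o : V) : IsProbabilityMeasure (pathMeasure P o) := by
  unfold pathMeasure; infer_instance

/-- The distribution of the path up to time `n`. -/
noncomputable def initialMeasure (P : Kernel V V) (o : V) (n : ℕ) :
    Measure ((i : Finset.Iic n) → (fun _ : ℕ => V) i) :=
  Kernel.partialTraj (X := fun _ => V) (pathStep P) 0 n (fun _ => o)

lemma map_frestrictLe_pathMeasure (P : Kernel V V) [IsMarkovKernel P] (o : V) (n : ℕ) :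
    (pathMeasure P o).map (Preorder.frestrictLe n) = initialMeasure P o n :=
  Kernel.traj_map_frestrictLe_apply ..

/-- The Markov property at time `n`, which reduces statements about step `n + 1` to the kernel `P`.
-/
lemma pathMeasure_eq_bind (P : Kernel V V) [IsMarkovKernel P] (o : V) (n : ℕ) :
    pathMeasure P o =
      (initialMeasure P o n).bind (Kernel.traj (X := fun _ => V) (pathStep P) n) := by
  rw [pathMeasure, ← Kernel.traj_comp_partialTraj (X := fun _ => V) (κ := pathStep P)
    (Nat.zero_le n), Kernel.comp_apply]
  rfl

lemma map_eval_pathMeasure (P : Kernel V V) [IsMarkovKernel P] (o : V) (n : ℕ) :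
    (pathMeasure P o).map (fun x => x n) = (P ^ n) o := by
  have hmap : ∀ n, (pathMeasure P o).map (fun x => x n) =
      (initialMeasure P o n).map (fun y => y ⟨n, Finset.mem_Iic.2 le_rfl⟩) := by
    intro n
    rw [← map_frestrictLe_pathMeasure, Measure.map_map (by fun_prop) (by fun_prop)]
    rfl
  induction n with
  | zero =>
    rw [hmap, initialMeasure, Kernel.partialTraj_self, Kernel.id_apply, pow_zero]
    refine (Measure.map_dirac' (measurable_pi_apply _) _).trans ?_
    exact (Kernel.id_apply o).symm
  | succ n ih =>
    ext s hs
    rw [Measure.map_apply (by fun_prop) hs, pathMeasure_eq_bind P o n,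
      Measure.bind_apply (measurable_pi_apply _ hs) (Kernel.aemeasurable _), 
      Kernel.pow_succ_apply_eq_lintegral _ _ _ hs, ← ih, hmap,
      lintegral_map (P.measurable_coe hs) (by fun_prop)]
    refine lintegral_congr fun y => ?_
    have h1 : ((Kernel.traj (X := fun _ => V) (pathStep P) n).map (fun x => x (n + 1))) y s =
        pathStep P n y s := by
      rw [Kernel.map_traj_succ_self]
    rwa [Kernel.map_apply' _ (by fun_prop) _ hs] at h1

lemma ae_adj [Countable V] [DiscreteMeasurableSpace V] {G : SimpleGraph V} {P : Kernel V V}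
    [IsMarkovKernel P] (hP : IsNearestNeighbor G P) (o : V) :
    ∀ᵐ x ∂(pathMeasure P o), ∀ n, G.Adj (x n) (x (n + 1)) := by
  rw [ae_all_iff]
  intro n
  have hm : MeasurableSet {x : ℕ → V | ¬ G.Adj (x n) (x (n + 1))} :=
    measurableSet_preimage (f := fun x : ℕ → V => (x n, x (n + 1))) (by fun_prop)
      (MeasurableSet.of_discrete (s := {p : V × V | ¬ G.Adj p.1 p.2}))
  rw [ae_iff, pathMeasure_eq_bind P o n, Measure.bind_apply hm (Kernel.aemeasurable _)]
  simp only [lintegral_eq_zero_iff (Kernel.measurable_coe _ hm)]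
  refine Eventually.of_forall fun y => ?_
  change Kernel.traj (X := fun _ => V) (pathStep P) n y {x | ¬ G.Adj (x n) (x (n + 1))} = 0
  rw [← ae_iff]
  have h1 : ∀ᵐ x ∂(Kernel.traj (X := fun _ => V) (pathStep P) n y),
      x n = y ⟨n, Finset.mem_Iic.2 le_rfl⟩ := by
    have h := Kernel.traj_map_frestrictLe_apply (X := fun _ => V) (κ := pathStep P) n n y
    rw [Kernel.partialTraj_self, Kernel.id_apply] at h
    have h2 : ∀ᵐ z ∂((Kernel.traj (X := fun _ => V) (pathStep P) n y).map
        (Preorder.frestrictLe n)), z ⟨n, Finset.mem_Iic.2 le_rfl⟩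
          = y ⟨n, Finset.mem_Iic.2 le_rfl⟩ := by
      rw [h, ae_dirac_iff]
      exact measurable_pi_apply _ (MeasurableSet.of_discrete (s := {v | v = _}))
    exact ae_of_ae_map (by fun_prop) h2
  have h2 : ∀ᵐ x ∂(Kernel.traj (X := fun _ => V) (pathStep P) n y),
      G.Adj (y ⟨n, Finset.mem_Iic.2 le_rfl⟩) (x (n + 1)) := by
    have h := congrArg (fun η => η y)
      (Kernel.map_traj_succ_self (X := fun _ => V) (κ := pathStep P) (a := n))
    simp only [Kernel.map_apply _ (measurable_pi_apply (n + 1))] at h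
    have h3 : ∀ᵐ v ∂((Kernel.traj (X := fun _ => V) (pathStep P) n y).map (fun x => x (n + 1))),
        G.Adj (y ⟨n, Finset.mem_Iic.2 le_rfl⟩) v := by
      rw [h]; exact hP _
    exact ae_of_ae_map (measurable_pi_apply (n + 1)).aemeasurable h3
  filter_upwards [h1, h2] with x hx1 hx2
  rwa [hx1]

end Markov

/-! ### Measurability of the limit, and measures of shadows. -/

section Boundary

variable {V : Type*} {G : SimpleGraph V} {o : V} {δ : ℝ}

instance : BorelSpace (Boundary G o) := ⟨rfl⟩

lemma measurableSet_shadow [MeasurableSpace V] [DiscreteMeasurableSpace V] (c : ℝ) (w : V) :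
    MeasurableSet (shadow G o c w) := by
  have : shadow G o c w = ⋃ M : ℕ, ⋂ n : ℕ, ⋂ _ : M ≤ n,
      (fun x : ℕ → V => x n) ⁻¹' {y | (G.dist w o : ℝ) - c ≤ gromovProduct G o w y} := by
    ext x; simp [shadow, eventually_atTop]
  rw [this]
  exact .iUnion fun _ => .iInter fun n => .iInter fun _ =>
    measurable_pi_apply n MeasurableSet.of_discrete

/-- Paths that track rays have a measurable limit. -/
lemma exists_measurable_boundaryMap [Countable V] [MeasurableSpace V] [DiscreteMeasurableSpace V]
    (hc : G.Connected) (h0 : 0 ≤ δ) (hδ : ∀ x y z w : V,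
      min (gromovProduct G w x z) (gromovProduct G w y z) - δ ≤ gromovProduct G w x y)
    {l : ℝ} (hl : 0 < l) {μ : Measure (ℕ → V)} [NeZero μ]
    (h : ∀ᵐ x ∂μ, ∃ γ : GeodesicRay G o, Tracks G o l x γ) :
    ∃ bnd : (ℕ → V) → Boundary G o, Measurable bnd ∧
      ∀ᵐ x ∂μ, ConvergesTo G o l x (bnd x) := by
  classical
  obtain ⟨x₀, γ₀, -⟩ := h.exists
  obtain ⟨T, hT, hTm, hTγ⟩ := h.exists_measurable_mem
  have : Nonempty (GeodesicRay G o) := ⟨γ₀⟩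
  choose! γ hγ using hTγ
  refine ⟨fun x => if x ∈ T then (γ x).toBoundary else γ₀.toBoundary, ?_, ?_⟩
  · refine measurable_of_isOpen fun U hU => ?_
    -- The choice of `γ x` need not be measurable, but `U` is detected by the countably many shadows
    -- on which all limits lie in `U`. Each limit in `U` has such a shadow at a high level `k`: rays
    -- through it are `6δ`-close at level `k`, whence the margin `3δ + 2δ` below.
    have hpre : ∀ x ∈ T, (γ x).toBoundary ∈ U ↔ x ∈ ⋃ w : V,
        ⋃ _ : ∀ y ∈ T, y ∈ shadow G o δ w → (γ y).toBoundary ∈ U, shadow G o δ w := by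
      intro x hx
      simp only [Set.mem_iUnion, exists_prop]
      refine ⟨fun hxU => ?_, fun ⟨w, hw, hxw⟩ => hw x hx hxw⟩
      obtain ⟨r, hr, hrU⟩ := hU _ hxU
      obtain ⟨k, hk⟩ := exists_nat_gt (-Real.log r + 5 * δ)
      have hbase := (γ x).dist_base k
      refine ⟨(γ x).vertex k, fun y hy hyw => hrU ?_, ?_⟩
      · have h1 := (hγ y hy).dist_le_of_mem_shadow hc h0 hδ hl h0 hyw
        rw [hbase] at h1
        rw [show r = Real.exp (-(-Real.log r)) by rw [neg_neg, Real.exp_log hr], mem_rhoBall_exp]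
        refine lt_of_lt_of_le ?_ (le_boundaryProduct h0 hδ _ _ h1)
        rw [EReal.coe_lt_coe_iff]; linarith
      · have h2 := (hγ x hx).mem_shadow (R := 0) (w := (γ x).vertex k) hc hδ hl
          (by rw [hbase]; simp)
        rwa [zero_add] at h2
    have hset : (fun x => if x ∈ T then (γ x).toBoundary else γ₀.toBoundary) ⁻¹' U =
        T.ite (⋃ w : V, ⋃ _ : ∀ y ∈ T, y ∈ shadow G o δ w → (γ y).toBoundary ∈ U,
          shadow G o δ w) {_x | γ₀.toBoundary ∈ U} := by
      ext x
      by_cases hx : x ∈ T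
      · simpa [Set.ite, hx] using hpre x hx
      · simp [Set.ite, hx]
    rw [hset]
    exact hTm.ite (.iUnion fun w => .iUnion fun _ => measurableSet_shadow δ w) (.const _)
  · filter_upwards [hT] with x hx
    rw [if_pos hx]
    exact ⟨γ x, rfl, hγ x hx⟩

/-- The measure of a ball around a limit point is at most that of a shadow. -/
lemma map_rhoBall_le_shadow [MeasurableSpace V] [DiscreteMeasurableSpace V]
    (hc : G.Connected) (h0 : 0 ≤ δ) (hδ : ∀ x y z w : V,
      min (gromovProduct G w x z) (gromovProduct G w y z) - δ ≤ gromovProduct G w x y)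
    {l : ℝ} (hl : 0 < l) {μ : Measure (ℕ → V)} {bnd : (ℕ → V) → Boundary G o}
    (hm : AEMeasurable bnd μ) (hb : ∀ᵐ x ∂μ, ConvergesTo G o l x (bnd x))
    (γ : GeodesicRay G o) (k : ℕ) :
    μ.map bnd (rhoBall G o γ.toBoundary (Real.exp (-((k + ⌈1 + 14 * δ⌉₊ : ℕ) : ℝ)))) ≤
      μ (shadow G o (12 * δ + δ) (γ.vertex k)) := by
  -- The open hull `U` has a computable image measure; the shift of the radius by `⌈1 + 14δ⌉₊`
  -- absorbs the enlargement.
  obtain ⟨U, hU, hsub, hUb⟩ := exists_isOpen_rhoBall_subset hc h0 hδ γ.toBoundary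
    (t := ((k + ⌈1 + 14 * δ⌉₊ : ℕ) : ℝ)) (Nat.cast_nonneg _)
  refine (measure_mono hsub).trans ?_
  rw [Measure.map_apply_of_aemeasurable hm hU.measurableSet]
  refine measure_mono_ae ?_
  filter_upwards [hb] with y hy hyU
  obtain ⟨γ', hγ', htr⟩ := hy
  have h1 := hUb _ hyU
  rw [← hγ'] at h1
  have h2 := dist_le_of_lt_boundaryProduct (k := k) hc h0 hδ γ γ' h1 (by
    push_cast; linarith [Nat.le_ceil (1 + 14 * δ)])
  refine Tracks.mem_shadow (γ := γ') hc hδ hl htr ?_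
  rwa [γ.dist_base]

/-- Shadows at a given level have bounded multiplicity. -/
lemma sum_measure_shadow_le [MeasurableSpace V] [DiscreteMeasurableSpace V]
    (hc : G.Connected) (h0 : 0 ≤ δ) (hδ : ∀ x y z w : V,
      min (gromovProduct G w x z) (gromovProduct G w y z) - δ ≤ gromovProduct G w x y)
    {D : ℕ} {N : V → Finset V}
    (hD : ∀ u, (N u).card ≤ D) (hN : ∀ u v, G.Adj u v → v ∈ N u)
    {l : ℝ} (hl : 0 < l) {μ : Measure (ℕ → V)} [IsProbabilityMeasure μ]
    (h : ∀ᵐ x ∂μ, ∃ γ : GeodesicRay G o, Tracks G o l x γ)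
    {c : ℝ} (hc0 : 0 ≤ c) (k : ℕ) (F : Finset V) (hF : ∀ w ∈ F, G.dist w o = k) :
    ∑ w ∈ F, μ (shadow G o c w) ≤ ((D + 1) ^ ⌊2 * c + 4 * δ⌋₊ : ℕ) := by
  classical
  calc ∑ w ∈ F, μ (shadow G o c w)
      = ∫⁻ x, ∑ w ∈ F, (shadow G o c w).indicator 1 x ∂μ := by
        rw [lintegral_finsetSum _ fun w _ => measurable_one.indicator (measurableSet_shadow c w)]
        exact Finset.sum_congr rfl fun w _ =>
          (lintegral_indicator_one (measurableSet_shadow c w)).symm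
    _ ≤ ∫⁻ _, ((D + 1) ^ ⌊2 * c + 4 * δ⌋₊ : ℕ) ∂μ := by
        refine lintegral_mono_ae ?_
        filter_upwards [h] with x ⟨γ, hγ⟩
        -- All `w ∈ F` whose shadow contains `x` lie within `2c + 4δ` of `γ k`.
        obtain ⟨B, hB, hB'⟩ := exists_finset_ball hc hD hN (γ.vertex k) ⌊2 * c + 4 * δ⌋₊
        simp only [Set.indicator_apply, Pi.one_apply, Finset.sum_ite, Finset.sum_const_zero,
          add_zero, Finset.sum_const, nsmul_eq_mul, mul_one]
        refine Nat.cast_le.2 ((Finset.card_le_card fun w hw => hB' w ?_).trans hB)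
        obtain ⟨hwF, hw⟩ := Finset.mem_filter.1 hw
        have := hγ.dist_le_of_mem_shadow hc h0 hδ hl hc0 hw
        rw [hF w hwF] at this
        exact Nat.le_floor this
    _ = _ := by simp

/-- A density estimate: at almost every point of `A`, the shadows are not much larger than
their parts in `A`. -/
lemma ae_eventually_measure_shadow_le [MeasurableSpace V] [DiscreteMeasurableSpace V]
    (hc : G.Connected) (h0 : 0 ≤ δ) (hδ : ∀ x y z w : V,
      min (gromovProduct G w x z) (gromovProduct G w y z) - δ ≤ gromovProduct G w x y)
    {D : ℕ} {N : V → Finset V}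
    (hD : ∀ u, (N u).card ≤ D) (hN : ∀ u v, G.Adj u v → v ∈ N u)
    {l : ℝ} (hl : 0 < l) {μ : Measure (ℕ → V)} [IsProbabilityMeasure μ]
    (h : ∀ᵐ x ∂μ, ∃ γ : GeodesicRay G o, Tracks G o l x γ)
    {c : ℝ} (hc0 : 0 ≤ c) (A : Set (ℕ → V)) {ε : ℝ} (hε : 0 < ε) :
    ∀ᵐ x ∂μ, x ∈ A → ∀ᶠ k : ℕ in atTop, ∀ w, G.dist w o = k → x ∈ shadow G o c w →
      ENNReal.ofReal (Real.exp (k * -ε)) * μ (shadow G o c w) ≤ μ (A ∩ shadow G o c w) := by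
  classical
  choose B _ hB using fun k : ℕ => exists_finset_ball hc hD hN o k
  set M : ℕ := (D + 1) ^ ⌊2 * c + 4 * δ⌋₊ with hM
  let bad : ℕ → Finset V := fun k => (B k).filter fun w => G.dist w o = k ∧
    μ (A ∩ shadow G o c w) < ENNReal.ofReal (Real.exp (k * -ε)) * μ (shadow G o c w)
  -- Bounded multiplicity turns the proportion `e^{-kε}` into a summable bound. Only subadditivity
  -- is used on `A`, which need not be measurable.
  have hsum : ∀ k, μ (⋃ w ∈ bad k, A ∩ shadow G o c w) ≤
      ENNReal.ofReal (Real.exp (k * -ε) * M) := by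
    intro k
    calc μ (⋃ w ∈ bad k, A ∩ shadow G o c w)
        ≤ ∑ w ∈ bad k, μ (A ∩ shadow G o c w) := measure_biUnion_finset_le _ _
      _ ≤ ∑ w ∈ bad k, ENNReal.ofReal (Real.exp (k * -ε)) * μ (shadow G o c w) :=
          Finset.sum_le_sum fun w hw => (Finset.mem_filter.1 hw).2.2.le
      _ ≤ ENNReal.ofReal (Real.exp (k * -ε)) * M := by
          rw [← Finset.mul_sum]
          gcongr
          exact sum_measure_shadow_le hc h0 hδ hD hN hl h hc0 k _ fun w hw =>
            (Finset.mem_filter.1 hw).2.1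
      _ = _ := by rw [ENNReal.ofReal_mul (Real.exp_pos _).le, ENNReal.ofReal_natCast]
  have hfin : ∑' k, μ (⋃ w ∈ bad k, A ∩ shadow G o c w) ≠ ⊤ := by
    have hs : Summable fun k : ℕ => Real.exp (k * -ε) * M :=
      (Real.summable_exp_nat_mul_iff.2 (neg_lt_zero.2 hε)).mul_right _
    exact ne_top_of_le_ne_top hs.tsum_ofReal_ne_top (ENNReal.tsum_le_tsum hsum)
  filter_upwards [ae_eventually_notMem hfin] with x hx hxA
  filter_upwards [hx] with k hk w hwk hxw
  by_contra hlt
  refine hk (Set.mem_iUnion₂.2 ⟨w, Finset.mem_filter.2 ⟨hB k w hwk.le, hwk, not_le.1 hlt⟩, hxA, hxw⟩)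

/-- A bound on the decay of balls bounds the lower local dimension from below. -/
lemma le_lowerLocalDim {ν : Measure (Boundary G o)} {ξ : Boundary G o} {a C : ℝ} {c : ℕ}
    (h : ∀ᶠ k : ℕ in atTop, ν (rhoBall G o ξ (Real.exp (-((k + c : ℕ) : ℝ)))) ≤
      ENNReal.ofReal (Real.exp (-(k * a) + C))) {ε : ℝ} (hε : 0 < ε) :
    ((a - ε : ℝ) : EReal) ≤ lowerLocalDim G o ν ξ := by
  obtain ⟨K, hK⟩ := eventually_atTop.1 h
  have hlog : Tendsto (fun r : ℝ => -Real.log r) (𝓝[>] 0) atTop :=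
    tendsto_neg_atBot_atTop.comp Real.tendsto_log_nhdsGT_zero
  refine le_liminf_of_le (by isBoundedDefault) ?_
  filter_upwards [self_mem_nhdsWithin, hlog.eventually_ge_atTop ((K + c : ℕ) : ℝ),
    hlog.eventually_gt_atTop 0,
    (hlog.const_mul_atTop hε).eventually_ge_atTop (|a| * (c + 1) + C)] with r hr h1 h2 h3
  have hr : 0 < r := hr
  -- Here `⌊-log r⌋ = k + K + c`, so `-log r` differs from `k + K` by at most `c + 1`; `|a|` appears
  -- as `a` may be negative.
  obtain ⟨k, hk⟩ := Nat.exists_eq_add_of_le' (Nat.le_floor h1)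
  rw [← add_assoc] at hk
  have hf1 := Nat.floor_le h2.le
  have hf2 := Nat.lt_floor_add_one (-Real.log r)
  rw [hk] at hf1 hf2
  have hball : ν (rhoBall G o ξ r) ≤ ENNReal.ofReal (Real.exp ((a - ε) * Real.log r)) := by
    refine (measure_mono (rhoBall_mono G o ξ ?_)).trans
      ((hK (k + K) (Nat.le_add_left _ _)).trans (ENNReal.ofReal_le_ofReal (Real.exp_le_exp.2 ?_)))
    · rw [← Real.log_le_iff_le_exp hr]; linarith
    · push_cast at hf1 hf2 ⊢
      have h4 : a * (-Real.log r - (k + K)) ≤ |a| * (c + 1) := by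
        have h5 : 0 ≤ -Real.log r - (k + K) := by
          have : (0 : ℝ) ≤ c := c.cast_nonneg
          linarith
        refine (mul_le_mul_of_nonneg_right (le_abs_self a) h5).trans ?_
        exact mul_le_mul_of_nonneg_left (by linarith) (abs_nonneg a)
      linarith
  have hlogν : ENNReal.log (ν (rhoBall G o ξ r)) ≤ (((a - ε) * Real.log r : ℝ) : EReal) := by
    have := ENNReal.log_monotone hball
    rwa [← EReal.exp_coe, EReal.log_exp] at this
  refine le_trans (le_of_eq ?_) (EReal.div_le_div_right_of_nonpos (c := (Real.log r : EReal))
    (by exact_mod_cast (by linarith : Real.log r ≤ 0)) hlogν)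
  rw [← EReal.coe_div, mul_div_cancel_right₀ _ (by linarith : Real.log r < 0).ne]

end Boundary

end HypBdry

namespace HypBdry

/-! ### Typical paths and the entropy estimate. -/

section Dimension

variable {V : Type*} {G : SimpleGraph V} {o : V} {δ : ℝ}

lemma countable_of_connected (hc : G.Connected) {N : V → Finset V}
    {D : ℕ} (hD : ∀ u, (N u).card ≤ D) (hN : ∀ u v, G.Adj u v → v ∈ N u) : Countable V := by
  obtain ⟨o⟩ := hc.nonempty
  choose B _ hB using fun k : ℕ => exists_finset_ball hc hD hN o k
  rw [← Set.countable_univ_iff]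
  refine (Set.countable_iUnion fun k => (B k).countable_toSet).mono fun v _ => ?_
  exact Set.mem_iUnion.2 ⟨G.dist v o, hB _ v le_rfl⟩

variable [MeasurableSpace V]

/-- The paths that, from time `M` on, stay `ε n`-close to a ray and visit only points of small
transition probability. -/
def typicalPaths (G : SimpleGraph V) (P : Kernel V V) (o : V) (h l ε : ℝ) (M : ℕ) :
    Set (ℕ → V) :=
  {x | ∃ γ : GeodesicRay G o, Tracks G o l x γ ∧ ∀ n ≥ M,
    (G.dist (x n) (γ.vertex ⌊l * n⌋₊) : ℝ) ≤ ε * n ∧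
    ((P ^ n) o).real {x n} ≤ Real.exp (-(n * (h - ε)))}

lemma exists_mem_typicalPaths {P : Kernel V V} {h l ε : ℝ} (hε : 0 < ε) {x : ℕ → V}
    {γ : GeodesicRay G o} (hγ : Tracks G o l x γ)
    (hx : Tendsto (fun n : ℕ => -Real.log (((P ^ n) o).real {x n}) / n) atTop (𝓝 h)) :
    ∃ M, x ∈ typicalPaths G P o h l ε M := by
  obtain ⟨M, hM⟩ := eventually_atTop.1 ((hγ.eventually_dist_le hε).and
    ((hx.eventually_const_lt (show h - ε < h by linarith)).and (eventually_gt_atTop 0)))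
  refine ⟨M, γ, hγ, fun n hn => ⟨(hM n hn).1, ?_⟩⟩
  obtain ⟨-, h1, h2⟩ := hM n hn
  have hn0 : (0 : ℝ) < n := by exact_mod_cast h2
  rw [lt_div_iff₀ hn0] at h1
  -- Mass zero is treated apart, since `Real.log 0 = 0`.
  rcases (measureReal_nonneg (μ := (P ^ n) o) (s := {x n})).eq_or_lt with h3 | h3
  · rw [← h3]; positivity
  · rw [← Real.log_le_iff_le_exp h3]; linarith

/-- At time `n` a typical path in the shadow is in a ball around `w`: the radius adds the tracking
error `ε n`, the rounding `l + 1` and the distance `2c + 4δ` from the ray to `w`. Counting vertices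
times their maximal mass gives the bound. -/
lemma measure_typicalPaths_inter_shadow_le [DiscreteMeasurableSpace V]
    (hc : G.Connected) (h0 : 0 ≤ δ) (hδ : ∀ x y z w : V,
      min (gromovProduct G w x z) (gromovProduct G w y z) - δ ≤ gromovProduct G w x y)
    {D : ℕ} {N : V → Finset V}
    (hD : ∀ u, (N u).card ≤ D) (hN : ∀ u v, G.Adj u v → v ∈ N u)
    (P : Kernel V V) [IsMarkovKernel P] {h l ε : ℝ} (hl : 0 < l)
    {c : ℝ} (hc0 : 0 ≤ c) {M : ℕ} {w : V} {n : ℕ} (hn : n = ⌊(G.dist w o : ℝ) / l⌋₊)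
    (hM : M ≤ n) :
    pathMeasure P o (typicalPaths G P o h l ε M ∩ shadow G o c w) ≤
      ENNReal.ofReal ((D + 1) ^ ⌊ε * n + (l + 1) + (2 * c + 4 * δ)⌋₊ *
        Real.exp (-(n * (h - ε)))) := by
  classical
  set R := ⌊ε * n + (l + 1) + (2 * c + 4 * δ)⌋₊ with hR
  obtain ⟨B, hB, hB'⟩ := exists_finset_ball hc hD hN w R
  set F := B.filter fun v => ((P ^ n) o).real {v} ≤ Real.exp (-(n * (h - ε))) with hF
  have hsub : typicalPaths G P o h l ε M ∩ shadow G o c w ⊆ (fun x => x n) ⁻¹' (F : Set V) := by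
    rintro x ⟨⟨γ, hγ, hx⟩, hxw⟩
    obtain ⟨h1, h2⟩ := hx n hM
    refine Finset.mem_coe.2 (Finset.mem_filter.2 ⟨hB' _ (Nat.le_floor ?_), h2⟩)
    have h3 := hγ.dist_le_of_mem_shadow hc h0 hδ hl hc0 hxw
    have h4 := γ.dist_vertex_le ⌊l * n⌋₊ (G.dist w o)
    -- Rounding the time loses at most `l` in level, rounding `l n` at most `1`.
    have h5 : |((⌊l * n⌋₊ : ℕ) : ℝ) - (G.dist w o : ℝ)| ≤ l + 1 := by
      have e1 := Nat.floor_le (show 0 ≤ l * n by positivity)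
      have e2 := Nat.lt_floor_add_one (l * n)
      have e3 := Nat.floor_le (show 0 ≤ (G.dist w o : ℝ) / l by positivity)
      have e4 := Nat.lt_floor_add_one ((G.dist w o : ℝ) / l)
      rw [← hn, le_div_iff₀ hl] at e3
      rw [← hn, div_lt_iff₀ hl] at e4
      rw [abs_le]; constructor <;> linarith
    have h6 := dist_triangle_real hc (x n) (γ.vertex ⌊l * n⌋₊) w
    have h7 := dist_triangle_real hc (γ.vertex ⌊l * n⌋₊) (γ.vertex (G.dist w o)) w
    rw [G.dist_comm (u := γ.vertex (G.dist w o))] at h7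
    linarith
  have hprob : IsProbabilityMeasure ((P ^ n) o) := by
    rw [← map_eval_pathMeasure P o n]
    exact Measure.isProbabilityMeasure_map (measurable_pi_apply n).aemeasurable
  calc pathMeasure P o (typicalPaths G P o h l ε M ∩ shadow G o c w)
      ≤ pathMeasure P o ((fun x => x n) ⁻¹' (F : Set V)) := measure_mono hsub
    _ = (P ^ n) o F := by
        rw [← map_eval_pathMeasure P o n, Measure.map_apply (by fun_prop) .of_discrete]
    _ = ENNReal.ofReal (((P ^ n) o).real F) := by rw [ofReal_measureReal]
    _ ≤ _ := by
        refine ENNReal.ofReal_le_ofReal ?_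
        rw [← sum_measureReal_singleton]
        refine (Finset.sum_le_card_nsmul _ _ _ fun v hv => (Finset.mem_filter.1 hv).2).trans ?_
        rw [nsmul_eq_mul]
        gcongr
        exact_mod_cast (Finset.card_filter_le _ _).trans hB

/-- Almost every limit point has lower local dimension at least `h / l`, up to `ε`. -/
lemma ae_le_lowerLocalDim [DiscreteMeasurableSpace V]
    (hc : G.Connected) (h0 : 0 ≤ δ) (hδ : ∀ x y z w : V,
      min (gromovProduct G w x z) (gromovProduct G w y z) - δ ≤ gromovProduct G w x y)
    {D : ℕ} {N : V → Finset V}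
    (hD : ∀ u, (N u).card ≤ D) (hN : ∀ u v, G.Adj u v → v ∈ N u)
    {P : Kernel V V} [IsMarkovKernel P] {h l : ℝ} (hl : 0 < l)
    (hreg : ∀ᵐ x ∂(pathMeasure P o),
      Tendsto (fun n : ℕ => -Real.log (((P ^ n) o).real {x n}) / n) atTop (𝓝 h))
    {bnd : (ℕ → V) → Boundary G o} (hm : AEMeasurable bnd (pathMeasure P o))
    (hb : ∀ᵐ x ∂(pathMeasure P o), ConvergesTo G o l x (bnd x)) (hh : 0 ≤ h)
    {ε : ℝ} (hε : 0 < ε) :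
    ∀ᵐ x ∂(pathMeasure P o),
      ((h / l - ε : ℝ) : EReal) ≤ lowerLocalDim G o ((pathMeasure P o).map bnd) (bnd x) := by
  set μ := pathMeasure P o with hμ
  set c := 12 * δ + δ with hcdef
  have hc0 : 0 ≤ c := by positivity
  set L := Real.log (D + 1) with hL
  have hL0 : 0 ≤ L := Real.log_nonneg (by linarith [(D.cast_nonneg : (0 : ℝ) ≤ D)])
  -- `q` is the exponent lost per unit of `e`: `1` from the density estimate, `L / l` from counting
  -- vertices, `1 / l` from the entropy error. With `e q = ε / 2`, the other half of `ε` is left for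
  -- `le_lowerLocalDim`.
  set q := 1 + (L + 1) / l with hq
  have hq0 : 0 < q := by positivity
  set e := ε / 2 / q with he
  have he0 : 0 < e := by positivity
  have htr : ∀ᵐ x ∂μ, ∃ γ : GeodesicRay G o, Tracks G o l x γ := by
    filter_upwards [hb] with x ⟨γ, _, hγ⟩ using ⟨γ, hγ⟩
  have hdens : ∀ᵐ x ∂μ, ∀ M, x ∈ typicalPaths G P o h l e M → ∀ᶠ k : ℕ in atTop, ∀ w,
      G.dist w o = k → x ∈ shadow G o c w → ENNReal.ofReal (Real.exp (k * -e)) *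
        μ (shadow G o c w) ≤ μ (typicalPaths G P o h l e M ∩ shadow G o c w) :=
    ae_all_iff.2 fun M => ae_eventually_measure_shadow_le hc h0 hδ hD hN hl htr hc0 _ he0
  filter_upwards [hdens, hreg, hb] with x hx1 hx2 ⟨γ, hγ, hγt⟩
  obtain ⟨M, hM⟩ := exists_mem_typicalPaths (P := P) he0 hγt hx2
  rw [show h / l - ε = (h / l - ε / 2) - ε / 2 by ring, ← hγ]
  set C := (l + 1) + (2 * c + 4 * δ) with hC
  have hC0 : 0 ≤ C := by positivity
  -- `C * L` comes from the bounded part of the ball radius, `h` from `n ≥ k / l - 1`.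
  refine le_lowerLocalDim (C := C * L + h) (c := ⌈1 + 14 * δ⌉₊) ?_ (half_pos hε)
  have hlarge : ∀ᶠ k : ℕ in atTop, (M : ℝ) ≤ (k : ℝ) / l :=
    (tendsto_natCast_atTop_atTop.atTop_div_const hl).eventually_ge_atTop _
  filter_upwards [hx1 M hM, hlarge] with k hk1 hk2
  have hbase := γ.dist_base k
  refine (map_rhoBall_le_shadow hc h0 hδ hl hm hb γ k).trans ?_
  have hmem : x ∈ shadow G o c (γ.vertex k) :=
    Tracks.mem_shadow (γ := γ) hc hδ hl hγt (by
      rw [hbase, SimpleGraph.dist_self, Nat.cast_zero]; positivity)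
  have h1 := hk1 _ hbase hmem
  set n := ⌊(G.dist (γ.vertex k) o : ℝ) / l⌋₊ with hn
  have hMn : M ≤ n := by rw [hn, hbase]; exact Nat.le_floor hk2
  have h2 := h1.trans (measure_typicalPaths_inter_shadow_le (ε := e) hc h0 hδ hD hN P hl hc0 hn hMn)
  have hexp : ENNReal.ofReal (Real.exp (k * e)) * ENNReal.ofReal (Real.exp (k * -e)) = 1 := by
    rw [← ENNReal.ofReal_mul (Real.exp_pos _).le, ← Real.exp_add]; simp
  calc μ (shadow G o c (γ.vertex k))
      = ENNReal.ofReal (Real.exp (k * e)) *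
          (ENNReal.ofReal (Real.exp (k * -e)) * μ (shadow G o c (γ.vertex k))) := by
        rw [← mul_assoc, hexp, one_mul]
    _ ≤ _ := mul_le_mul_right h2 _
    _ ≤ _ := by
        rw [← ENNReal.ofReal_mul (Real.exp_pos _).le]
        refine ENNReal.ofReal_le_ofReal ?_
        set R := ⌊e * n + (l + 1) + (2 * c + 4 * δ)⌋₊ with hR
        have hDR : ((D : ℝ) + 1) ^ R = Real.exp (R * L) := by
          rw [mul_comm, Real.exp_mul, hL, Real.exp_log (by positivity), Real.rpow_natCast]
        rw [hDR, ← Real.exp_add, ← Real.exp_add, Real.exp_le_exp]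
        have hR1 : (R : ℝ) ≤ e * n + C := by
          rw [hC, ← add_assoc]; exact Nat.floor_le (by positivity)
        have hn1 : (n : ℝ) ≤ k / l := by rw [hn, hbase]; exact Nat.floor_le (by positivity)
        have hn2 : (k : ℝ) / l ≤ n + 1 := by
          rw [hn, hbase]; exact (Nat.lt_floor_add_one _).le
        have hqe : e * q = ε / 2 := by rw [he]; field_simp
        have a1 : R * L ≤ (e * n + C) * L := mul_le_mul_of_nonneg_right hR1 hL0
        have a2 : e * (L + 1) * n ≤ e * (L + 1) * (k / l) :=
          mul_le_mul_of_nonneg_left hn1 (by positivity)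
        have a3 : (k : ℝ) / l * h ≤ (n + 1) * h := mul_le_mul_of_nonneg_right hn2 hh
        have a4 : k * (ε / 2) = k * e + e * (L + 1) * (k / l) := by rw [← hqe, hq]; ring
        have a5 : (k : ℝ) * (h / l) = k / l * h := by ring
        linarith

end Dimension

/-! ### Cayley graphs, and the theorem. -/

section Cayley

variable {Γ : Type*} [Group Γ] {S : Set Γ}

lemma mulCayley_connected (hgen : Subgroup.closure S = ⊤) :
    (SimpleGraph.mulCayley S).Connected := by
  have hstep : ∀ x y : Γ, (x⁻¹ * y ∈ S ∨ y⁻¹ * x ∈ S) →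
      (SimpleGraph.mulCayley S).Reachable x y := by
    intro x y hxy
    by_cases h : x = y
    · rw [h]
    · exact SimpleGraph.Adj.reachable ((SimpleGraph.mulCayley_adj S x y).2 ⟨h, hxy⟩)
  have h1 : ∀ g : Γ, (SimpleGraph.mulCayley S).Reachable 1 g := by
    intro g
    have hg : g ∈ Subgroup.closure S := hgen ▸ Subgroup.mem_top g
    induction hg using Subgroup.closure_induction_right with
    | one => rfl
    | mul_right x _ y hy ih => exact ih.trans (hstep _ _ (Or.inl (by simpa using hy)))
    | mul_inv_cancel x _ y hy ih => exact ih.trans (hstep _ _ (Or.inr (by simpa using hy)))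
  have : Nonempty Γ := ⟨1⟩
  exact ⟨fun x y => (h1 x).symm.trans (h1 y)⟩

lemma exists_mulCayley_neighbors (hfin : S.Finite) (hsymm : S⁻¹ = S) :
    ∃ N : Γ → Finset Γ, (∀ u, (N u).card ≤ hfin.toFinset.card) ∧
      ∀ u v, (SimpleGraph.mulCayley S).Adj u v → v ∈ N u := by
  classical
  refine ⟨fun u => hfin.toFinset.image (u * ·), fun u => Finset.card_image_le, fun u v huv => ?_⟩
  refine Finset.mem_image.2 ⟨u⁻¹ * v, hfin.mem_toFinset.2 ?_, by simp⟩
  rcases ((SimpleGraph.mulCayley_adj S u v).1 huv).2 with h | h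
  · exact h
  · rw [← hsymm]; simpa using h

end Cayley

end HypBdry

open HypBdry in
theorem mainTheorem6 {Γ : Type*} [Group Γ] [MeasurableSpace Γ] [DiscreteMeasurableSpace Γ]
    (S : Set Γ) (hfin : S.Finite) (hsymm : S⁻¹ = S) (hone : (1 : Γ) ∉ S)
    (hgen : Subgroup.closure S = ⊤) (hne : ¬ HypBdry.IsElementary Γ)
    (hyp : HypBdry.IsHyperbolic (SimpleGraph.mulCayley S))
    (P : Kernel Γ Γ) [IsMarkovKernel P]
    (hnn : HypBdry.IsNearestNeighbor (SimpleGraph.mulCayley S) P)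
    (h l : ℝ) (hreg : HypBdry.IsRegular (SimpleGraph.mulCayley S) P 1 h l) (hl : 0 < l) :
    (∃! ν : Measure (HypBdry.Boundary (SimpleGraph.mulCayley S) 1),
      HypBdry.IsHarmonicMeasure (SimpleGraph.mulCayley S) P 1 l ν) ∧
    ∀ ν : Measure (HypBdry.Boundary (SimpleGraph.mulCayley S) 1),
      HypBdry.IsHarmonicMeasure (SimpleGraph.mulCayley S) P 1 l ν →
      ∀ ε : ℝ, 0 < ε →
        0 < ν {ξ | ((h / l - ε : ℝ) : EReal) ≤
          HypBdry.lowerLocalDim (SimpleGraph.mulCayley S) 1 ν ξ} := by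
  obtain ⟨δ, h0, hδ⟩ := hyp
  have hc := mulCayley_connected hgen
  obtain ⟨N, hD, hN⟩ := exists_mulCayley_neighbors hfin hsymm
  have : Countable Γ := countable_of_connected hc hD hN
  constructor
  · have htr : ∀ᵐ x ∂(pathMeasure P 1),
        ∃ γ : GeodesicRay (SimpleGraph.mulCayley S) 1, Tracks _ 1 l x γ := by
      filter_upwards [ae_adj hnn 1, hreg.tendsto_speed] with x hx hs
      exact exists_tracks hc h0 hδ hN hl hx hs
    obtain ⟨bnd, hbm, hb⟩ := exists_measurable_boundaryMap hc h0 hδ hl htr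
    refine ⟨(pathMeasure P 1).map bnd, ⟨bnd, hbm.aemeasurable, hb, rfl⟩, ?_⟩
    rintro _ ⟨bnd', _, hb', rfl⟩
    refine Measure.map_congr ?_
    filter_upwards [hb, hb'] with x ⟨γ, hγ, hγt⟩ ⟨γ', hγ', hγt'⟩
    rw [← hγ, ← hγ']
    exact Tracks.toBoundary_eq hc h0 hδ hl hγt' hγt
  · rintro _ ⟨bnd, hbm, hb, rfl⟩ ε hε
    have hae := ae_le_lowerLocalDim hc h0 hδ hD hN hl hreg.tendsto_entropy hbm hb
      hreg.entropy_nonneg hε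
    -- The set is not shown to be measurable; this inequality for image measures holds for every
    -- set.
    refine lt_of_lt_of_le ?_ (Measure.le_map_apply hbm _)
    rw [pos_iff_ne_zero]
    intro hzero
    obtain ⟨x, hx, hx'⟩ := (hae.and (measure_eq_zero_iff_ae_notMem.1 hzero)).exists
    exact hx' hx
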